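/- **Theorem.** All graphs are finite, simple and undirected. For a graph $G$ let $\rho(G)$ denote the largest eigenvalue of its adjacency matrix. Write $K_m$ for the complete graph on $m$ vertices, $cK_1$ for the graph with $c$ vertices and no edges, $\cup$ for the disjoint union, and $G_1\vee G_2$ for the join, obtained from $G_1\cup G_2$ by adding all edges between $V(G_1)$ and $V(G_2)$. A $k$-matching is a set of $k$ pairwise disjoint edges. A fractional perfect matching of $G$ is a function $h:E(G)\to[0,1]$ such that, for every vertex $v$, the sum of $h(e)$ over the edges $e$ incident with $v$ equals $1$. A graph $G$ with at least $2k+2$ vertices is fractional $k$-extendable if for every $k$-matching $M$ of $G$ there is a fractional perfect matching $h$ of $G$ with $h(e)=1$ for all $e\in M$. Let $k\ge 1$ be an integer, and let $G$ be a connected graph of order $n$ with minimum degree $\delta$, where $n\ge\max\{2k+9,\,5\delta+1\}$. Put $$G_2=K_{2k}\vee(K_{n-2k-1}\cup K_1),$$ and, if $\delta\ge 2k$, put $$G_3=K_{\delta}\vee\bigl(K_{n-2\delta+2k-1}\cup(\delta-2k+1)K_1\bigr).$$ Suppose that $\rho(G)\ge\rho(G_2)$ and, if $\delta\ge 2k$,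 also $\rho(G)\ge\rho(G_3)$. Then $G$ is fractional $k$-extendable, unless $G$ is isomorphic to $G_2$ or (if $\delta\ge 2k$) to $G_3$. -/

import Mathlib

open scoped SimpleGraph

namespace FracExt

/-- The join `G ∨ H`: the disjoint union of `G` and `H` together with all the edges between
a vertex of `G` and a vertex of `H`. -/
def join {V W : Type*} (G : SimpleGraph V) (H : SimpleGraph W) : SimpleGraph (V ⊕ W) :=
  (G ⊕g H) ⊔ completeBipartiteGraph V W

/-- The graph `K_a ∨ (K_b ∪ c K_1)`; here `c K_1` is the graph on `c` vertices without edges. -/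
def joinGraph (a b c : ℕ) : SimpleGraph (Fin a ⊕ (Fin b ⊕ Fin c)) :=
  join (⊤ : SimpleGraph (Fin a)) ((⊤ : SimpleGraph (Fin b)) ⊕g (⊥ : SimpleGraph (Fin c)))

open Classical in
/-- The spectral radius `ρ(G)`, that is the largest eigenvalue of the (real symmetric) adjacency
matrix of a finite non-empty graph `G`. -/
noncomputable def rho {V : Type*} [Fintype V] (G : SimpleGraph V) : ℝ :=
  sSup (spectrum ℝ (G.adjMatrix ℝ))

open Classical in
/-- `h` is a fractional perfect matching of `G`: every edge gets a weight in `[0, 1]`, and the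
weights of the edges incident with any given vertex add up to `1`. Only the values of `h` on
the edges of `G` matter. -/
def IsFractionalPerfectMatching {V : Type*} [Fintype V] (G : SimpleGraph V)
    (h : Sym2 V → ℝ) : Prop :=
  (∀ e ∈ G.edgeSet, 0 ≤ h e ∧ h e ≤ 1) ∧
    ∀ v : V, ∑ e ∈ G.incidenceFinset v, h e = 1

/-- `G` is fractional `k`-extendable: it has at least `2k + 2` vertices, and for every matching `M`
with exactly `k` edges there is a fractional perfect matching of weight `1` on each edge
of `M`. -/
def FractionalExtendable {V : Type*} [Fintype V] (G : SimpleGraph V) (k : ℕ) : Prop :=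
  2 * k + 2 ≤ Fintype.card V ∧
    ∀ M : G.Subgraph, M.IsMatching → M.edgeSet.ncard = k →
      ∃ h : Sym2 V → ℝ, IsFractionalPerfectMatching G h ∧ ∀ e ∈ M.edgeSet, h e = 1

end FracExt

/-! Let M be a k-matching with no suitable fractional perfect matching. A permutation moving every
vertex to a neighbour and swapping the ends of each edge of M would yield one, so Hall's condition
fails off M: some t + 1 vertices have all their neighbours in a set S of 2k + t vertices. Thus G is
a spanning subgraph of H = K_{2k+t} ∨ (K_b ∪ (t+1)K_1), where n = 2k + 2t + 1 + b.

Some x = n - 2 + ε is an eigenvalue of G_2, so x ≤ ρ(G). A positive vector z on H, constant on the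
three parts, satisfies the eigenvalue equation for x on the last two parts; on the clique K_{2k+t}
it holds with equality if t = 0 (`joinGraph_left_eq`), and with strict inequality if t ≥ 1
(`joinGraph_left_lt`). Now `eq_of_le_rho` forces G = H and equality everywhere, so t = 0 and H =
G_2. -/

namespace FracExt

section

open scoped Classical

/-! ### Spectral radius and Collatz–Wielandt comparison. -/

/-- The largest eigenvalue of the adjacency matrix has an eigenvector. -/
lemma exists_eigenvector_rho {V : Type*} [Fintype V] [Nonempty V] (G : SimpleGraph V) :
    ∃ u : V → ℝ, u ≠ 0 ∧ ∀ v, ∑ w, (if G.Adj v w then u w else 0) = rho G * u v := by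
  have hA : (G.adjMatrix ℝ).IsHermitian := G.isHermitian_adjMatrix ℝ
  have hmem : rho G ∈ spectrum ℝ (G.adjMatrix ℝ) := by
    refine Set.Nonempty.csSup_mem ?_ (Matrix.finite_real_spectrum)
    rw [hA.spectrum_real_eq_range_eigenvalues]
    exact Set.range_nonempty _
  rw [← Matrix.spectrum_toLin', ← Module.End.hasEigenvalue_iff_mem_spectrum] at hmem
  obtain ⟨u, hu⟩ := hmem.exists_hasEigenvector
  refine ⟨u, hu.2, fun v => ?_⟩
  have h := congrFun hu.apply_eq_smul v
  simpa [Matrix.mulVec, dotProduct, SimpleGraph.adjMatrix_apply] using h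

/-- An eigenvalue of the adjacency matrix is at most the spectral radius. -/
lemma le_rho_of_eigenvector {V : Type*} [Fintype V] (G : SimpleGraph V) (x : ℝ) (u : V → ℝ)
    (hu : u ≠ 0) (h : ∀ v, ∑ w, (if G.Adj v w then u w else 0) = x * u v) : x ≤ rho G := by
  refine le_csSup (Matrix.finite_real_spectrum).bddAbove ?_
  rw [← Matrix.spectrum_toLin']
  refine (Module.End.hasEigenvalue_of_hasEigenvector (x := u) ?_).mem_spectrum
  refine ⟨Module.End.mem_eigenspace_iff.2 ?_, hu⟩
  ext v
  simpa [Matrix.mulVec, dotProduct, SimpleGraph.adjMatrix_apply] using h v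

/-- A Collatz–Wielandt bound with its equality case: if a positive vector `z` satisfies
`A(H) z ≤ x z`, and `x` is at most the spectral radius of a connected spanning subgraph `G` of `H`,
then `G = H` and `A(H) z = x z`. -/
lemma eq_of_le_rho {V : Type*} [Fintype V] {G H : SimpleGraph V} (hG : G.Connected) (hle : G ≤ H)
    {z : V → ℝ} (hz : ∀ v, 0 < z v) {x : ℝ}
    (hx : ∀ v, ∑ w, (if H.Adj v w then z w else 0) ≤ x * z v) (hρ : x ≤ rho G) :
    G = H ∧ ∀ v, ∑ w, (if H.Adj v w then z w else 0) = x * z v := by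
  have := hG.nonempty
  obtain ⟨u, hu0, hu⟩ := exists_eigenvector_rho G
  obtain ⟨v₀, hv₀⟩ := Finite.exists_max (fun v => |u v| / z v)
  set m := |u v₀| / z v₀ with hm
  have hle_m : ∀ v, |u v| ≤ m * z v := fun v => (div_le_iff₀ (hz v)).1 (hv₀ v)
  have hmpos : 0 < m := by
    obtain ⟨v, hv⟩ := Function.ne_iff.1 hu0
    exact (div_pos (abs_pos.2 hv) (hz v)).trans_le (hv₀ v)
  -- At a vertex maximising |u| / z the chain ρ m z ≤ ∑_G |u| ≤ m ∑_H z ≤ x m z ≤ ρ m z collapses,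
  -- so every H-neighbour is a G-neighbour and again a maximiser; connectedness then reaches all
  -- vertices.
  have key : ∀ v, |u v| = m * z v →
      (∑ w, (if H.Adj v w then z w else 0) = x * z v) ∧
        ∀ w, H.Adj v w → G.Adj v w ∧ |u w| = m * z w := by
    intro v hv
    have h1 : rho G * (m * z v) ≤ ∑ w, (if G.Adj v w then |u w| else 0) := by
      calc rho G * (m * z v) ≤ |rho G * u v| := by
            rw [← hv, abs_mul]
            exact mul_le_mul_of_nonneg_right (le_abs_self _) (abs_nonneg _)
        _ ≤ ∑ w, |if G.Adj v w then u w else 0| := by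
            rw [← hu v]; exact Finset.abs_sum_le_sum_abs _ _
        _ = _ := Finset.sum_congr rfl fun w _ => by split_ifs <;> simp
    have h2 : ∀ w ∈ Finset.univ, (if G.Adj v w then |u w| else 0) ≤
        (if H.Adj v w then m * z w else 0) := by
      intro w _
      by_cases hg : G.Adj v w
      · simpa [hg, hle hg] using hle_m w
      · rw [if_neg hg]
        split_ifs
        · exact (mul_pos hmpos (hz w)).le
        · exact le_rfl
    have h3 : ∑ w, (if H.Adj v w then m * z w else 0) =
        m * ∑ w, (if H.Adj v w then z w else 0) := by
      rw [Finset.mul_sum]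
      exact Finset.sum_congr rfl fun w _ => by split_ifs <;> simp
    have h4 := mul_le_mul_of_nonneg_left (hx v) hmpos.le
    have h5 : x * (m * z v) ≤ rho G * (m * z v) :=
      mul_le_mul_of_nonneg_right hρ (mul_pos hmpos (hz v)).le
    have h6 := Finset.sum_le_sum h2
    refine ⟨?_, fun w hw => ?_⟩
    · have : m * ∑ w, (if H.Adj v w then z w else 0) = m * (x * z v) := by linarith
      exact mul_left_cancel₀ hmpos.ne' this
    · have h7 := (Finset.sum_eq_sum_iff_of_le h2).1 (by linarith) w (Finset.mem_univ w)
      rw [if_pos hw] at h7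
      by_cases hg : G.Adj v w
      · exact ⟨hg, by simpa [hg] using h7⟩
      · rw [if_neg hg] at h7
        exact absurd h7 (mul_pos hmpos (hz w)).ne
  have hall : ∀ v, |u v| = m * z v := by
    intro v
    obtain ⟨p⟩ := hG.preconnected v₀ v
    have : ∀ {a b : V}, G.Walk a b → |u a| = m * z a → |u b| = m * z b := by
      intro a b p
      induction p with
      | nil => exact id
      | cons h _ ih => exact fun ha => ih ((key _ ha).2 _ (hle h)).2
    exact this p (by rw [hm, div_mul_cancel₀ _ (hz v₀).ne'])
  refine ⟨le_antisymm hle fun v w h => ((key v (hall v)).2 w h).1, fun v => (key v (hall v)).1⟩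

/-! ### Row sums and the numerical estimates. -/

/-- The vector on `K_a ∨ (K_b ∪ c K_1)` with the values `p`, `q`, `r` on the three parts. -/
def partVector (a b c : ℕ) (p q r : ℝ) : Fin a ⊕ (Fin b ⊕ Fin c) → ℝ :=
  Sum.elim (fun _ => p) (Sum.elim (fun _ => q) (fun _ => r))

lemma sum_ne_const {a : ℕ} (i : Fin a) (p : ℝ) :
    ∑ j, (if i ≠ j then p else 0) = (a - 1) * p := by
  have : ∀ j : Fin a, (if i ≠ j then p else 0) = p - if i = j then p else 0 := by
    intro j; by_cases h : i = j <;> simp [h]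
  simp only [this, Finset.sum_sub_distrib, Finset.sum_ite_eq, Finset.mem_univ, if_true]
  simp
  ring

section sums
variable {a b c : ℕ} (p q r : ℝ)

lemma joinGraph_sum_left (i : Fin a) :
    ∑ w, (if (joinGraph a b c).Adj (.inl i) w then partVector a b c p q r w else 0) =
      (a - 1) * p + b * q + c * r := by
  have h := sum_ne_const i p
  simp only [ne_eq, ite_not] at h
  simp [Fintype.sum_sum_type, joinGraph, join, partVector, h]
  ring

lemma joinGraph_sum_middle (i : Fin b) :
    ∑ w, (if (joinGraph a b c).Adj (.inr (.inl i)) w then partVector a b c p q r w else 0) =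
      a * p + (b - 1) * q := by
  have h := sum_ne_const i q
  simp only [ne_eq, ite_not] at h
  simp only [Fintype.sum_sum_type, joinGraph, join, partVector]
  simp
  convert h

lemma joinGraph_sum_right (i : Fin c) :
    ∑ w, (if (joinGraph a b c).Adj (.inr (.inr i)) w then partVector a b c p q r w else 0) =
      a * p := by
  simp [Fintype.sum_sum_type, joinGraph, join, partVector]

end sums

/-- The parametrisation `a + N - 2 + ε` of the largest eigenvalue of `K_a ∨ (K_{N-1} ∪ K_1)`. -/
lemma exists_eps {a N : ℝ} (ha : 1 ≤ a) (hN : 9 ≤ N) :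
    ∃ ε : ℝ, 0 < ε ∧ ε * ((a + N - 2 + ε) * (a + N - 1 + ε)) = a * (a + ε) := by
  have hc : ContinuousOn
      (fun ε : ℝ => ε * ((a + N - 2 + ε) * (a + N - 1 + ε)) - a * (a + ε)) (Set.Icc 0 1) := by
    fun_prop
  have h0 : (0 : ℝ) ∈ Set.Ioo ((fun ε : ℝ => ε * ((a + N - 2 + ε) * (a + N - 1 + ε)) - a * (a + ε)) 0)
      ((fun ε : ℝ => ε * ((a + N - 2 + ε) * (a + N - 1 + ε)) - a * (a + ε)) 1) := by
    constructor <;> simp only <;> nlinarith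
  obtain ⟨ε, hε, h⟩ := intermediate_value_Ioo zero_le_one hc h0
  exact ⟨ε, hε.1, by simpa [sub_eq_zero] using h⟩

/-- The row of a clique vertex of H, with a = 2k, N = n - 2k and b = N - 2t - 1. After clearing
denominators, `h` replaces ε x (x + 1) by a (a + ε) and a factor t cancels; what remains is `hxx`,
whose case ε = 0 follows from `hpoly`. -/
lemma joinGraph_left_lt {a N t ε x : ℝ} (ha : 1 ≤ a) (hN : 9 ≤ N) (ht : 1 ≤ t)
    (htN : 2 * t + 1 ≤ N) (hε : 0 < ε) (hxε : x = a + N - 2 + ε)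
    (h : ε * (x * (x + 1)) = a * (a + ε)) :
    (a + t - 1) + (N - 2 * t - 1) * ((a + t) / (a + 2 * t + ε)) + (t + 1) * ((a + t) / x) < x := by
  have hx0 : 0 < x := by linarith
  have hd : 0 < a + 2 * t + ε := by linarith
  have hpoly : a ^ 2 + (t + 1) * (3 * a + 2 * t) ≤ (a + N - 2) * (a + N - 1) := by
    -- The bounds N ≥ 9 and N ≥ 2t + 1 agree at t = 4; there, with N = 9, both sides have the same
    -- coefficient 15 of a.
    by_cases h4 : t ≤ 4
    · nlinarith [mul_nonneg (sub_nonneg.2 ha) (sub_nonneg.2 h4),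
        mul_nonneg (sub_nonneg.2 ht) (sub_nonneg.2 h4)]
    · push Not at h4
      have : (a + 2 * t - 1) * (a + 2 * t) ≤ (a + N - 2) * (a + N - 1) := by
        apply mul_le_mul <;> linarith
      nlinarith [mul_nonneg (sub_nonneg.2 ha) (sub_nonneg.2 h4.le)]
  have hxx : a ^ 2 + (t + 1) * (3 * a + 2 * t) + ε * (a + t + 1) < x * (x + 1) := by
    subst hxε
    nlinarith [mul_pos hε hε, mul_nonneg hε.le (by linarith : 0 ≤ a + 2 * N - t - 4)]
  have hmain : (t + 1) * (a + t) * (a + 2 * t + ε) < (t + ε) * (x * (x + 1)) := by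
    have := mul_lt_mul_of_pos_left hxx (by linarith : 0 < t)
    nlinarith
  have e : x - ((a + t - 1) + (N - 2 * t - 1) * ((a + t) / (a + 2 * t + ε))
      + (t + 1) * ((a + t) / x)) =
      ((t + ε) * (x * (x + 1)) - (t + 1) * (a + t) * (a + 2 * t + ε)) /
        (x * (a + 2 * t + ε)) := by
    field_simp
    subst hxε
    ring
  have := div_pos (sub_pos.2 hmain) (mul_pos hx0 hd)
  linarith

/-- Here t = 0, and clearing denominators leaves exactly the equation defining ε. -/
lemma joinGraph_left_eq {a N ε x : ℝ} (ha : 1 ≤ a) (hN : 9 ≤ N)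
    (hε : 0 < ε) (hxε : x = a + N - 2 + ε)
    (h : ε * (x * (x + 1)) = a * (a + ε)) :
    (a - 1) + (N - 1) * (a / (a + ε)) + a / x = x := by
  have hx0 : 0 < x := by linarith
  have hd : 0 < a + ε := by linarith
  have e : x - ((a - 1) + (N - 1) * (a / (a + ε)) + a / x) =
      (ε * (x * (x + 1)) - a * (a + ε)) / (x * (a + ε)) := by
    field_simp
    subst hxε
    ring
  rw [h, sub_self, zero_div] at e
  linarith

/-! ### Fractional matchings, Hall's theorem and the structure of G. -/

/-- A permutation of the vertices which moves every vertex to a neighbour yields a fractional perfect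
matching, of weight `1` on the edges whose ends it interchanges. -/
lemma exists_isFractionalPerfectMatching_of_injective {V : Type*} [Fintype V] (G : SimpleGraph V)
    (f : V → V) (hf : Function.Injective f) (hadj : ∀ v, G.Adj v (f v)) :
    ∃ h : Sym2 V → ℝ, IsFractionalPerfectMatching G h ∧
      ∀ v w, v ≠ w → f v = w → f w = v → h s(v, w) = 1 := by
  have hcard : ∀ v w : V, v ≠ w →
      (Finset.univ.filter fun u => s(u, f u) = s(v, w)) ⊆ {v, w} := by
    intro v w _ u hu
    have := (Finset.mem_filter.1 hu).2
    rw [Sym2.eq_iff] at this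
    simp only [Finset.mem_insert, Finset.mem_singleton]
    tauto
  -- Each u gives weight 1/2 to the edge from u to `f u`. A vertex v meets two of these
  -- contributions, from v and from its preimage; an interchanged pair contributes twice to its
  -- edge.
  refine ⟨fun e => ((Finset.univ.filter fun u => s(u, f u) = e).card : ℝ) / 2, ⟨?_, ?_⟩, ?_⟩
  · intro e
    induction e with
    | _ v w =>
      intro he
      have hne : v ≠ w := (G.mem_edgeSet.1 he).ne
      refine ⟨by positivity, ?_⟩
      have h1 := Finset.card_le_card (hcard v w hne)
      rw [Finset.card_pair hne] at h1
      have : ((Finset.univ.filter fun u => s(u, f u) = s(v, w)).card : ℝ) ≤ 2 := by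
        exact_mod_cast h1
      linarith
  · intro v
    obtain ⟨u₀, hu₀⟩ := Finite.surjective_of_injective hf v
    have hne : v ≠ u₀ := by
      rintro rfl
      exact (hadj v).ne hu₀.symm
    have hset : (Finset.univ.filter fun u => s(u, f u) ∈ G.incidenceFinset v) = {v, u₀} := by
      ext u
      simp only [Finset.mem_filter, Finset.mem_univ, true_and, Finset.mem_insert,
        Finset.mem_singleton, SimpleGraph.mem_incidenceFinset, SimpleGraph.incidenceSet,
        Set.mem_ofPred_eq, SimpleGraph.mem_edgeSet, hadj u, Sym2.mem_iff]
      constructor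
      · rintro (h | h)
        · exact Or.inl h.symm
        · exact Or.inr (hf (hu₀.trans h).symm)
      · rintro (h | h)
        · exact Or.inl h.symm
        · exact Or.inr (h ▸ hu₀.symm)
    have hsum := Finset.card_eq_sum_card_fiberwise (s := Finset.univ.filter fun u =>
      s(u, f u) ∈ G.incidenceFinset v) (t := G.incidenceFinset v) (f := fun u => s(u, f u))
      (fun u hu => (Finset.mem_filter.1 hu).2)
    rw [hset, Finset.card_pair hne] at hsum
    rw [← Finset.sum_div, ← Nat.cast_sum]
    have : ∑ e ∈ G.incidenceFinset v, (Finset.univ.filter fun u => s(u, f u) = e).card = 2 := by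
      rw [hsum]
      refine Finset.sum_congr rfl fun e he => ?_
      rw [← hset, Finset.filter_filter]
      congr 1
      ext u
      simp only [Finset.mem_filter, Finset.mem_univ, true_and]
      exact ⟨fun h => ⟨h ▸ he, h⟩, fun h => h.2⟩
    rw [this]
    norm_num
  · intro v w hne hv hw
    have : (Finset.univ.filter fun u => s(u, f u) = s(v, w)) = {v, w} := by
      refine (hcard v w hne).antisymm fun u hu => ?_
      simp only [Finset.mem_insert, Finset.mem_singleton] at hu
      rcases hu with rfl | rfl
      · simp [hv]
      · simp [hw]
    simp only [this, Finset.card_pair hne]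
    norm_num

/-- Hall's theorem for the graph `G - U`: if no injection of the complement of `U` into itself moves
every vertex to a neighbour, then `G - U` has an independent set with too few neighbours. -/
lemma exists_injOn_or_exists_independent {V : Type*} [Fintype V] (G : SimpleGraph V)
    (U : Finset V) :
    (∃ g : V → V, Set.InjOn g {v | v ∉ U} ∧ ∀ v ∉ U, g v ∉ U ∧ G.Adj v (g v)) ∨
      ∃ I T : Finset V, Disjoint I U ∧ Disjoint T U ∧ Disjoint I T ∧ T.card < I.card ∧
        ∀ v ∈ I, ∀ w, G.Adj v w → w ∈ U ∪ T := by
  let N : {v // v ∉ U} → Finset V := fun v => Finset.univ.filter fun w => w ∉ U ∧ G.Adj v w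
  by_cases hall : ∀ X : Finset {v // v ∉ U}, X.card ≤ (X.biUnion N).card
  · left
    obtain ⟨f, hf, hfN⟩ := (Finset.all_card_le_biUnion_card_iff_exists_injective N).1 hall
    refine ⟨fun v => if h : v ∉ U then f ⟨v, h⟩ else v, ?_, ?_⟩
    · intro v hv w hw h
      simp only [Set.mem_ofPred_eq] at hv hw
      simp only [hv, hw, not_false_eq_true, dite_true] at h
      exact congrArg Subtype.val (hf h)
    · intro v hv
      simp only [hv, not_false_eq_true, dite_true]
      exact (Finset.mem_filter.1 (hfN ⟨v, hv⟩)).2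
  · right
    push Not at hall
    obtain ⟨X, hX⟩ := hall
    set Y : Finset V := X.map ⟨Subtype.val, Subtype.val_injective⟩ with hY
    set T := X.biUnion N with hT
    have hYU : ∀ v ∈ Y, v ∉ U := by
      intro v hv
      obtain ⟨y, -, rfl⟩ := Finset.mem_map.1 hv
      exact y.2
    have hTmem : ∀ w, w ∈ T ↔ w ∉ U ∧ ∃ v ∈ Y, G.Adj v w := by
      intro w
      simp only [hT, N, hY, Finset.mem_biUnion, Finset.mem_filter, Finset.mem_univ, true_and,
        Finset.mem_map, Function.Embedding.coeFn_mk]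
      constructor
      · rintro ⟨y, hy, hw, h⟩
        exact ⟨hw, y, ⟨y, hy, rfl⟩, h⟩
      · rintro ⟨hw, _, ⟨y, hy, rfl⟩, h⟩
        exact ⟨y, hy, hw, h⟩
    have hYc : Y.card = X.card := Finset.card_map _
    -- Removing Y ∩ T from both sides keeps the deficiency and makes the first set independent: a
    -- vertex of Y with a neighbour in Y lies in T.
    refine ⟨Y \ T, T \ Y, ?_, ?_, ?_, ?_, ?_⟩
    · rw [Finset.disjoint_left]
      exact fun v hv => hYU v (Finset.mem_sdiff.1 hv).1
    · rw [Finset.disjoint_left]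
      exact fun v hv => ((hTmem v).1 (Finset.mem_sdiff.1 hv).1).1
    · rw [Finset.disjoint_left]
      exact fun v hv hv' => (Finset.mem_sdiff.1 hv).2 (Finset.mem_sdiff.1 hv').1
    · have h1 := Finset.card_sdiff_add_card_inter Y T
      have h2 := Finset.card_sdiff_add_card_inter T Y
      rw [Finset.inter_comm] at h2
      omega
    · intro v hv w hvw
      rw [Finset.mem_sdiff] at hv
      by_cases hw : w ∈ U
      · exact Finset.mem_union_left _ hw
      · refine Finset.mem_union_right _ (Finset.mem_sdiff.2 ⟨(hTmem w).2 ⟨hw, v, hv.1, hvw⟩, ?_⟩)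
        exact fun hwY => hv.2 ((hTmem v).2 ⟨hYU v hv.1, w, hwY, hvw.symm⟩)

/-- A matching with `k` edges covers `2k` vertices. -/
lemma card_verts_of_isMatching {V : Type*} [Fintype V] {G : SimpleGraph V} {M : G.Subgraph}
    (hM : M.IsMatching) : M.verts.toFinset.card = 2 * M.edgeSet.ncard := by
  rw [Set.ncard_eq_toFinset_card']
  have := Finset.card_mul_eq_card_mul (fun (v : V) (e : Sym2 V) => v ∈ e)
    (s := M.verts.toFinset) (t := M.edgeSet.toFinset) (m := 1) (n := 2) ?_ ?_
  · omega
  · intro v hv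
    rw [Set.mem_toFinset] at hv
    obtain ⟨w, hw, huniq⟩ := hM hv
    rw [Finset.card_eq_one]
    refine ⟨s(v, w), ?_⟩
    ext e
    simp only [Finset.mem_bipartiteAbove, Set.mem_toFinset, Finset.mem_singleton]
    constructor
    · rintro ⟨he, hve⟩
      obtain ⟨y, rfl⟩ := hve
      rw [huniq y he]
    · rintro rfl
      exact ⟨hw, Sym2.mem_mk_left _ _⟩
  · intro e he
    rw [Set.mem_toFinset] at he
    induction e with
    | _ v w =>
      have h : M.Adj v w := he
      rw [← Finset.card_pair h.ne]
      congr 1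
      ext u
      simp only [Finset.mem_bipartiteBelow, Set.mem_toFinset, Sym2.mem_iff, Finset.mem_insert,
        Finset.mem_singleton, and_iff_right_iff_imp]
      rintro (rfl | rfl)
      · exact h.fst_mem
      · exact h.snd_mem

/-- A graph which is not fractional `k`-extendable has a set `S = U ∪ T` containing a `k`-matching
that covers `U`, such that `G - S` has more than `|S| - 2k` isolated vertices. -/
lemma fractionalExtendable_or_exists_isolated {V : Type*} [Fintype V] (G : SimpleGraph V) (k : ℕ)
    (hcard : 2 * k + 2 ≤ Fintype.card V) :
    FractionalExtendable G k ∨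
      ∃ (t : ℕ) (S C : Finset V), S.card = 2 * k + t ∧ C.card = t + 1 ∧ Disjoint S C ∧
        ∀ v ∈ C, ∀ w, G.Adj v w → w ∈ S := by
  rw [or_iff_not_imp_left]
  intro hne
  simp only [FractionalExtendable, hcard, true_and, not_forall] at hne
  obtain ⟨M, hM, hMk, hno⟩ := hne
  rcases exists_injOn_or_exists_independent G M.verts.toFinset with ⟨g, hg, hgU⟩ |
    ⟨I, T, hIU, hTU, hIT, hlt, hN⟩
  · refine absurd ?_ hno
    simp only [Set.mem_toFinset] at hg hgU
    have : Nonempty V := Fintype.card_pos_iff.1 (by omega)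
    have hM' : ∀ v, v ∈ M.verts → ∃ w, M.Adj v w ∧ ∀ y, M.Adj v y → y = w := fun v hv => hM hv
    choose! p hp hpu using hM'
    -- Partners on the matching, Hall's map off it; both preserve their domains, so injectivity can
    -- be checked separately.
    let f : V → V := fun v => if v ∈ M.verts then p v else g v
    have hinj : Function.Injective f := by
      intro v w hvw
      by_cases hv : v ∈ M.verts <;> by_cases hw : w ∈ M.verts <;>
        simp only [f, hv, hw, if_true, if_false] at hvw
      · have h2 := (hp w hw).symm
        rw [← hvw] at h2
        exact ((hpu _ (hp v hv).snd_mem v (hp v hv).symm).trans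
          (hpu _ (hp v hv).snd_mem w h2).symm)
      · exact absurd (hvw ▸ (hp v hv).snd_mem) (hgU w hw).1
      · exact absurd (hvw ▸ (hp w hw).snd_mem) (hgU v hv).1
      · exact hg hv hw hvw
    have hadj : ∀ v, G.Adj v (f v) := by
      intro v
      by_cases hv : v ∈ M.verts
      · simpa only [f, hv, if_true] using (hp v hv).adj_sub
      · simpa only [f, hv, if_false] using (hgU v hv).2
    obtain ⟨h, hh, h1⟩ := exists_isFractionalPerfectMatching_of_injective G
      f hinj hadj
    refine ⟨h, hh, fun e => ?_⟩
    induction e with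
    | _ v w =>
      intro he
      have hvw : M.Adj v w := he
      refine h1 v w hvw.ne ?_ ?_
      · simp only [f, hvw.fst_mem, if_true]
        exact (hpu _ hvw.fst_mem w hvw).symm
      · simp only [f, hvw.snd_mem, if_true]
        exact (hpu _ hvw.snd_mem v hvw.symm).symm
  · obtain ⟨C, hCI, hC⟩ := Finset.exists_subset_card_eq (Nat.succ_le_of_lt hlt)
    refine ⟨T.card, M.verts.toFinset ∪ T, C, ?_, hC, ?_, fun v hv w => hN v (hCI hv) w⟩
    · rw [Finset.card_union_of_disjoint hTU.symm, card_verts_of_isMatching hM, hMk]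
    · exact Finset.disjoint_of_subset_right hCI (Finset.disjoint_union_left.2 ⟨hIU.symm, hIT.symm⟩)

/-- If the neighbours of the vertices in `C` all lie in `S`, then `G` is a spanning subgraph
of `K_s ∨ (K_b ∪ c K_1)`, where `s = |S|` and `c = |C|`. -/
lemma exists_equiv_le_comap_joinGraph {V : Type*} [Fintype V] {G : SimpleGraph V} {s b c : ℕ}
    {S C : Finset V} (hS : S.card = s) (hC : C.card = c) (hb : s + b + c = Fintype.card V)
    (hSC : Disjoint S C) (hN : ∀ v ∈ C, ∀ w, G.Adj v w → w ∈ S) :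
    ∃ e : V ≃ Fin s ⊕ (Fin b ⊕ Fin c), G ≤ (joinGraph s b c).comap e := by
  have hB : (S ∪ C)ᶜ.card = b := by
    rw [Finset.card_compl, Finset.card_union_of_disjoint hSC]
    omega
  let eS := (S.equivFinOfCardEq hS).symm
  let eB := ((S ∪ C)ᶜ.equivFinOfCardEq hB).symm
  let eC := (C.equivFinOfCardEq hC).symm
  let g : Fin s ⊕ (Fin b ⊕ Fin c) → V :=
    Sum.elim (fun i => eS i) (Sum.elim (fun i => eB i) (fun i => eC i))
  have hSC' := Finset.disjoint_left.1 hSC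
  have hBS : ∀ i, (eB i : V) ∉ S := fun i h =>
    Finset.mem_compl.1 (eB i).2 (Finset.mem_union_left _ h)
  have hBC : ∀ i, (eB i : V) ∉ C := fun i h =>
    Finset.mem_compl.1 (eB i).2 (Finset.mem_union_right _ h)
  have hinj : Function.Injective g := by
    refine (Subtype.val_injective.comp eS.injective).sumElim
      ((Subtype.val_injective.comp eB.injective).sumElim
        (Subtype.val_injective.comp eC.injective) ?_) ?_
    · exact fun i j (h : (eB i : V) = eC j) => hBC i (h ▸ (eC j).2)
    · rintro i (j | j) h
      · replace h : (eS i : V) = eB j := h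
        exact hBS j (h ▸ (eS i).2)
      · replace h : (eS i : V) = eC j := h
        exact hSC' (eS i).2 (h ▸ (eC j).2)
  let e := Equiv.ofBijective g
    ((Fintype.bijective_iff_injective_and_card g).2 ⟨hinj, by simp [← hb]; omega⟩)
  refine ⟨e.symm, fun v w hvw => ?_⟩
  obtain ⟨x, rfl⟩ := e.surjective v
  obtain ⟨y, rfl⟩ := e.surjective w
  simp only [SimpleGraph.comap_adj, Equiv.symm_apply_apply]
  have hxy : x ≠ y := by
    rintro rfl
    exact hvw.ne rfl
  replace hvw : G.Adj (g x) (g y) := hvw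
  rcases x with x | x | x <;> rcases y with y | y | y
  · simpa [joinGraph, join] using hxy
  · simp [joinGraph, join]
  · simp [joinGraph, join]
  · simp [joinGraph, join]
  · simpa [joinGraph, join] using hxy
  · exact absurd (hN _ (eC y).2 _ hvw.symm) (hBS x)
  · simp [joinGraph, join]
  · exact absurd (hN _ (eC x).2 _ hvw) (hBS y)
  · exact absurd (eC y).2 (hSC' (hN _ (eC x).2 _ hvw))

end

/-! ### Comparison with G_2. -/

open scoped Classical in
/-- A connected graph of order `n ≥ 2k + 9` whose spectral radius is at least that of
`K_{2k} ∨ (K_{n-2k-1} ∪ K_1)` is fractional `k`-extendable, unless it is that graph. No condition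
on the minimum degree is needed. -/
theorem fractionalExtendable_or_nonempty_iso {V : Type*} [Fintype V] {G : SimpleGraph V} {k : ℕ}
    (hk : 1 ≤ k) (hG : G.Connected) (hn : 2 * k + 9 ≤ Fintype.card V)
    (hρ : rho (joinGraph (2 * k) (Fintype.card V - 2 * k - 1) 1) ≤ rho G) :
    FractionalExtendable G k ∨
      Nonempty (G ≃g joinGraph (2 * k) (Fintype.card V - 2 * k - 1) 1) := by
  rw [or_iff_not_imp_left]
  intro hne
  obtain ⟨t, S, C, hS, hC, hSC, hN⟩ :=
    (fractionalExtendable_or_exists_isolated G k (by omega)).resolve_left hne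
  have hle : 2 * k + 2 * t + 1 ≤ Fintype.card V := by
    have := Finset.card_le_univ (S ∪ C)
    rw [Finset.card_union_of_disjoint hSC] at this
    omega
  obtain ⟨N, hNn⟩ : ∃ N, Fintype.card V = 2 * k + N := ⟨_, (Nat.add_sub_of_le (by omega)).symm⟩
  obtain ⟨b, hb⟩ : ∃ b, N = b + (2 * t + 1) := ⟨N - (2 * t + 1), by omega⟩
  obtain ⟨e, he⟩ := exists_equiv_le_comap_joinGraph (b := b) hS hC (by omega) hSC hN
  have ha : (1 : ℝ) ≤ 2 * k := by exact_mod_cast (by omega : 1 ≤ 2 * k)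
  have hN9 : (9 : ℝ) ≤ N := by exact_mod_cast (by omega : 9 ≤ N)
  have hbR : (N : ℝ) = b + (2 * t + 1) := by exact_mod_cast hb
  obtain ⟨ε, hε, hroot⟩ := exists_eps ha hN9
  obtain ⟨x, hxε⟩ : ∃ x : ℝ, x = 2 * k + N - 2 + ε := ⟨_, rfl⟩
  have hx0 : 0 < x := by linarith
  have hx1 : ε * (x * (x + 1)) = 2 * k * (2 * k + ε) := by
    rw [← hroot, hxε]; ring
  have hxρ : x ≤ rho G := by
    refine le_trans ?_ hρ
    rw [show Fintype.card V - 2 * k - 1 = N - 1 by omega]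
    -- This is the vector z below at t = 0.
    refine le_rho_of_eigenvector _ x
      (partVector (2 * k) (N - 1) 1 1 (2 * k / (2 * k + ε)) (2 * k / x)) ?_ ?_
    · exact fun h => one_ne_zero (congrFun h (.inl ⟨0, by omega⟩))
    · have hc : ((N - 1 : ℕ) : ℝ) = N - 1 := by rw [Nat.cast_sub (by omega), Nat.cast_one]
      rintro (i | i | i)
      · rw [joinGraph_sum_left, hc]
        have := joinGraph_left_eq ha hN9 hε hxε hx1
        simp only [partVector, Sum.elim_inl]
        push_cast
        linarith
      · rw [joinGraph_sum_middle, hc]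
        simp only [partVector, Sum.elim_inl, Sum.elim_inr]
        push_cast
        rw [hxε]
        field_simp
        ring
      · rw [joinGraph_sum_right]
        simp only [partVector, Sum.elim_inr]
        push_cast
        field_simp
  have hd : 0 < 2 * k + 2 * t + ε := by positivity
  have hleft := fun ht : (1 : ℝ) ≤ t => joinGraph_left_lt ha hN9 ht (by rw [hbR]; simp) hε hxε hx1
  have hleft₀ := joinGraph_left_eq ha hN9 hε hxε hx1
  -- The last two values solve their own rows for x; the middle denominator is x - b + 1.
  let z := partVector (2 * k + t) b (t + 1) 1 ((2 * k + t) / (2 * k + 2 * t + ε))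
    ((2 * k + t) / x)
  -- The instance is spelled out to match `eq_of_le_rho`, where H is a variable.
  have hsum : ∀ v, ∑ w, @ite _ (((joinGraph (2 * k + t) b (t + 1)).comap e).Adj v w)
      (Classical.propDecidable _) (z (e w)) 0 = ∑ y, (if (joinGraph (2 * k + t) b (t + 1)).Adj (e v) y then z y else 0) := by
    intro v
    rw [← Equiv.sum_comp e]
    rfl
  have hz : ∀ y, 0 < z y := by
    rintro (i | i | i) <;> simp only [z, partVector, Sum.elim_inl, Sum.elim_inr] <;> positivity
  have hlex : ∀ y, ∑ w, (if (joinGraph (2 * k + t) b (t + 1)).Adj y w then z w else 0) ≤ x * z y := by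
    rintro (i | i | i)
    · rw [joinGraph_sum_left]
      simp only [z, partVector, Sum.elim_inl]
      push_cast
      rcases Nat.eq_zero_or_pos t with rfl | ht
      · have : (b : ℝ) = N - 1 := by rw [hbR]; push_cast; ring
        rw [this]
        push_cast
        simp only [mul_zero, add_zero, zero_add, mul_one, one_mul] at hleft₀ ⊢
        exact hleft₀.le
      · have := hleft (by exact_mod_cast ht)
        rw [show (N : ℝ) - 2 * t - 1 = b by rw [hbR]; ring] at this
        linarith
    · rw [joinGraph_sum_middle]
      simp only [z, partVector, Sum.elim_inl, Sum.elim_inr]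
      push_cast
      rw [hxε, hbR]
      refine le_of_eq ?_
      field_simp
      ring
    · rw [joinGraph_sum_right]
      simp only [z, partVector, Sum.elim_inr]
      push_cast
      refine le_of_eq ?_
      field_simp
  obtain ⟨hGH, heq⟩ := eq_of_le_rho hG he (z := fun v => z (e v)) (fun v => hz _) (x := x)
    (fun v => by rw [hsum]; exact hlex _) hxρ
  rcases Nat.eq_zero_or_pos t with rfl | ht
  · obtain rfl : b = Fintype.card V - 2 * k - 1 := by omega
    exact ⟨hGH ▸ SimpleGraph.Iso.comap e _⟩
  · exfalso
    have h1 := heq (e.symm (.inl ⟨0, by omega⟩))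
    rw [hsum, Equiv.apply_symm_apply, joinGraph_sum_left] at h1
    simp only [z, partVector, Sum.elim_inl] at h1
    push_cast at h1
    have := hleft (by exact_mod_cast ht)
    rw [show (N : ℝ) - 2 * t - 1 = b by rw [hbR]; ring] at this
    linarith

end FracExt

theorem theorem1p2 {V : Type*} [Fintype V] (G : SimpleGraph V) [DecidableRel G.Adj]
    (k n δ : ℕ) (hk : 1 ≤ k) (hG : G.Connected)
    (hn : Fintype.card V = n) (hδ : G.minDegree = δ)
    (hn_ge : max (2 * k + 9) (5 * δ + 1) ≤ n)
    (hρ₁ : FracExt.rho (FracExt.joinGraph (2 * k) (n - 2 * k - 1) 1) ≤ FracExt.rho G)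
    (hρ₂ : 2 * k ≤ δ →
      FracExt.rho (FracExt.joinGraph δ (n + 2 * k - 2 * δ - 1) (δ + 1 - 2 * k)) ≤
        FracExt.rho G) :
    FracExt.FractionalExtendable G k ∨
      Nonempty (G ≃g FracExt.joinGraph (2 * k) (n - 2 * k - 1) 1) ∨
      (2 * k ≤ δ ∧
        Nonempty (G ≃g FracExt.joinGraph δ (n + 2 * k - 2 * δ - 1) (δ + 1 - 2 * k))) := by
  subst hn
  rcases FracExt.fractionalExtendable_or_nonempty_iso hk hG
    ((le_max_left _ _).trans hn_ge) hρ₁ with h | h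
  · exact Or.inl h
  · exact Or.inr (Or.inl h)
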